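/- A \emph{biframe} is a triple $L=(L_0,L_1,L_2)$ where $L_0$ is a frame and $L_1,L_2$ are subframes of $L_0$ whose union is a subbasis of $L_0$ (every element of $L_0$ is a join of finite meets of elements of $L_1\cup L_2$). A biframe homomorphism $f\colon L\to M$ is a frame homomorphism $f_0\colon L_0\to M_0$ with $f_0[L_i]\subseteq M_i$ for $i=1,2$. For an object $X$ of a category, let $\mathcal{S}(X)$ be the poset of equivalence classes $\langle f\rangle$ of extremal epimorphisms $f$ with domain $X$, ordered by $\langle f\rangle\le\langle g\rangle$ iff $f=h\cdot g$ for some morphism $h$. For a biframe $L$ (in the category of biframes) the elements of $\mathcal{S}(L)$ are the \emph{subbilocales} of $L$; for a frame (in the category of frames) they are its \emph{sublocales}. For a biframe $L$ and an extremal epimorphism $f\colon L_0\to S$ of frames, let $f_i\colon L_i\to f[L_i]$ be the restrictions of $f$, let $q_L\colon L_1\oplus L_2\to L_0$ be the map out of the frame coproduct induced by the inclusions $L_i\to L_0$, and let $\overline{f}$, with domain $L_0$, be the pushout of $f_1\oplus f_2\colon L_1\oplus L_2\to f[L_1]\oplus f[L_2]$ along $q_L$ in the category of frames. For every biframe $L$: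 \begin{enumerate} \item The poset $\mathcal{S}(L)$ of subbilocales of $L$ is a complete lattice. \item For every extremal epimorphism $f$ of frames with domain $L_0$, the map $\overline{f}$ exists and is again an extremal epimorphism of frames, and $\langle f\rangle\mapsto\langle\overline{f}\rangle$ is a well-defined closure operator $B_L$ on $\mathcal{S}(L_0)$. \item If $f\colon L\to M$ is an extremal epimorphism of biframes, then $f_0\colon L_0\to M_0$ is an extremal epimorphism of frames, and $\langle f\rangle\mapsto\langle f_0\rangle$ is an order isomorphism from $\mathcal{S}(L)$ onto the poset of fixed points of $B_L$. \end{enumerate} -/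

import Mathlib

open CategoryTheory CategoryTheory.Limits

universe u

/-! ## Subframes -/

/-- A subframe of a frame: a subset closed under arbitrary joins and finite meets
(including the empty ones, so it contains `⊥` and `⊤`). -/
structure Subframe (α : Type u) [Order.Frame α] where
  carrier : Set α
  top_mem' : ⊤ ∈ carrier
  inf_mem' : ∀ a ∈ carrier, ∀ b ∈ carrier, a ⊓ b ∈ carrier
  sSup_mem' : ∀ s : Set α, s ⊆ carrier → sSup s ∈ carrier

namespace Subframe

section

variable {α β : Type u} [Order.Frame α] [Order.Frame β]

instance : SetLike (Subframe α) α where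
  coe A := A.carrier
  coe_injective := by
    rintro ⟨⟩ ⟨⟩ h
    cases h
    rfl

theorem top_mem (A : Subframe α) : (⊤ : α) ∈ A := A.top_mem'

theorem inf_mem (A : Subframe α) {a b : α} (ha : a ∈ A) (hb : b ∈ A) : a ⊓ b ∈ A :=
  A.inf_mem' a ha b hb

theorem sSup_coe_mem (A : Subframe α) (s : Set A) : sSup (Subtype.val '' s) ∈ A :=
  A.sSup_mem' _ (by rintro _ ⟨x, -, rfl⟩; exact x.2)

instance (A : Subframe α) : SupSet A where
  sSup s := ⟨sSup (Subtype.val '' s), A.sSup_coe_mem s⟩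

/-- The complete lattice structure on a subframe; its finite meets and arbitrary joins are
computed in the ambient frame. -/
instance (A : Subframe α) : CompleteLattice A where
  __ := completeLatticeOfSup A fun s =>
    ⟨fun _ ha => le_sSup (α := α) (Set.mem_image_of_mem Subtype.val ha),
      fun b hb => sSup_le (α := α) (by rintro _ ⟨x, hx, rfl⟩; exact hb hx)⟩
  inf a b := ⟨a.1 ⊓ b.1, A.inf_mem a.2 b.2⟩
  inf_le_left a b := inf_le_left (α := α) (a := a.1) (b := b.1)
  inf_le_right a b := inf_le_right (α := α) (a := a.1) (b := b.1)
  le_inf a b c hab hac := le_inf (α := α) (show (a : α) ≤ b from hab) hac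
  top := ⟨⊤, A.top_mem⟩
  le_top a := le_top (α := α) (a := a.1)

theorem coe_inf (A : Subframe α) (a b : A) : ((a ⊓ b : A) : α) = (a : α) ⊓ b := rfl

theorem coe_sSup (A : Subframe α) (s : Set A) :
    ((sSup s : A) : α) = sSup (Subtype.val '' s) := rfl

theorem coe_top (A : Subframe α) : ((⊤ : A) : α) = ⊤ := rfl

theorem inf_sSup_le (A : Subframe α) (a : A) (s : Set A) :
    a ⊓ sSup s ≤ ⨆ b ∈ s, a ⊓ b := by
  change (a : α) ⊓ sSup (Subtype.val '' s) ≤ ((⨆ b ∈ s, a ⊓ b : A) : α)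
  rw [inf_sSup_eq]
  refine iSup₂_le ?_
  rintro _ ⟨b, hb, rfl⟩
  exact (le_iSup₂ (f := fun (b : A) (_ : b ∈ s) => a ⊓ b) b hb : a ⊓ b ≤ ⨆ b ∈ s, a ⊓ b)

/-- A subframe is a frame in its own right. -/
instance (A : Subframe α) : Order.Frame A :=
  Order.Frame.ofMinimalAxioms ⟨A.inf_sSup_le⟩

/-- The inclusion of a subframe, as a frame homomorphism. -/
def subtype (A : Subframe α) : FrameHom A α where
  toFun := Subtype.val
  map_inf' _ _ := rfl
  map_top' := rfl
  map_sSup' _ := rfl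

/-- The image `f[A]` of a subframe under a frame homomorphism. -/
def map (f : FrameHom α β) (A : Subframe α) : Subframe β where
  carrier := f '' A
  top_mem' := ⟨⊤, A.top_mem, map_top f⟩
  inf_mem' := by
    rintro _ ⟨a, ha, rfl⟩ _ ⟨b, hb, rfl⟩
    exact ⟨a ⊓ b, A.inf_mem ha hb, map_inf f a b⟩
  sSup_mem' := by
    intro s hs
    refine ⟨sSup {a | a ∈ A ∧ f a ∈ s}, A.sSup_mem' _ fun a ha => ha.1, ?_⟩
    rw [map_sSup]
    congr 1
    ext y
    constructor
    · rintro ⟨a, ha, rfl⟩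
      exact ha.2
    · intro hy
      obtain ⟨a, ha, rfl⟩ := hs hy
      exact ⟨a, ⟨ha, hy⟩, rfl⟩

/-- The restriction `A → f[A]` of a frame homomorphism to a subframe and its image. -/
def mapRestrict (f : FrameHom α β) (A : Subframe α) : FrameHom A (A.map f) where
  toFun a := ⟨f a, a, a.2, rfl⟩
  map_inf' a b := Subtype.ext (map_inf f (a : α) b)
  map_top' := Subtype.ext (map_top f)
  map_sSup' s := Subtype.ext (by
    change f (sSup (Subtype.val '' s)) = sSup (Subtype.val '' ((fun a : A => _) '' s))
    rw [map_sSup, Set.image_image, Set.image_image])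

end

end Subframe

/-! ## The category of biframes -/

/-- A biframe `L = (L₀, L₁, L₂)`: two subframes `L₁`, `L₂` of a frame `L₀` whose union is a
subbasis of `L₀`, i.e. every element of `L₀` is a join of finite meets of elements of
`L₁ ∪ L₂`. -/
structure BiFrm where
  /-- The ambient frame `L₀`. -/
  ambient : Frm.{u}
  /-- The first component `L₁`. -/
  fst : Subframe ambient
  /-- The second component `L₂`. -/
  snd : Subframe ambient
  subbasis : ∀ x : ambient, ∃ B : Set ambient,
    (∀ b ∈ B, ∃ F : Finset ambient, (F : Set ambient) ⊆ (fst : Set ambient) ∪ snd ∧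
      b = F.inf id) ∧ x = sSup B

namespace BiFrm

/-- A biframe homomorphism `L → M`: a frame homomorphism `L₀ → M₀` that maps `L₁` into `M₁`
and `L₂` into `M₂`. -/
@[ext]
structure Hom (L M : BiFrm.{u}) where
  base : L.ambient ⟶ M.ambient
  map_fst : ∀ a ∈ L.fst, base.hom a ∈ M.fst
  map_snd : ∀ a ∈ L.snd, base.hom a ∈ M.snd

instance : Category BiFrm.{u} where
  Hom L M := Hom L M
  id L := ⟨𝟙 L.ambient, fun _ h => h, fun _ h => h⟩
  comp f g := ⟨f.base ≫ g.base, fun a h => g.map_fst _ (f.map_fst a h),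
    fun a h => g.map_snd _ (f.map_snd a h)⟩

end BiFrm

/-! ## The poset of extremal quotients of an object -/

section

variable {C : Type*} [Category C]

/-- An extremal epimorphism with domain `X`. -/
structure ExtremalQuot (X : C) where
  obj : C
  hom : X ⟶ obj
  ext : ExtremalEpi hom

/-- The preorder on extremal epimorphisms out of `X`:
`f ≲ g` iff `f = h ∘ g` for some morphism `h`. -/
instance (X : C) : Preorder (ExtremalQuot X) where
  le f g := ∃ h : g.obj ⟶ f.obj, g.hom ≫ h = f.hom
  le_refl f := ⟨𝟙 _, Category.comp_id _⟩
  le_trans f g k := by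
    rintro ⟨a, ha⟩ ⟨b, hb⟩
    exact ⟨b ≫ a, by rw [← Category.assoc, hb, ha]⟩

/-- The poset `𝒮(X)`: the posetal reflection of the preorder of extremal epimorphisms out of
`X`. For a frame its elements are the sublocales, for a biframe the subbilocales. -/
abbrev ExtSub (X : C) : Type _ := Antisymmetrization (ExtremalQuot X) (· ≤ ·)

/-- The class `⟨f⟩` of an extremal epimorphism `f`. -/
def ExtSub.mk {X Y : C} (f : X ⟶ Y) (hf : ExtremalEpi f) : ExtSub X :=
  toAntisymmetrization (· ≤ ·) (⟨Y, f, hf⟩ : ExtremalQuot X)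

end

/-! ## The quotient `f̄` induced by a quotient `f` of the ambient frame -/

namespace BiFrm

variable (L : BiFrm.{u})

/-- The first component frame, as an object of the category of frames. -/
abbrev fstFrm : Frm.{u} := Frm.of L.fst

/-- The second component frame, as an object of the category of frames. -/
abbrev sndFrm : Frm.{u} := Frm.of L.snd

/-- The inclusion `e₁ : L₁ → L₀`. -/
abbrev inclFst : L.fstFrm ⟶ L.ambient := Frm.ofHom L.fst.subtype

/-- The inclusion `e₂ : L₂ → L₀`. -/
abbrev inclSnd : L.sndFrm ⟶ L.ambient := Frm.ofHom L.snd.subtype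

/-- `f̄` is the map induced by the frame homomorphism `f : L₀ → S`. There are coproducts
`L₁ ⊕ L₂` (with injections `i₁`, `i₂`) and `f[L₁] ⊕ f[L₂]` (with injections `j₁`, `j₂`) in the
category of frames such that `f̄` is the pushout of `f₁ ⊕ f₂` along `q_L`:
```
  L₁ ⊕ L₂ -------- q_L -------> L₀
     |                          |
  f₁ ⊕ f₂                       f̄
     v                          v
  f[L₁] ⊕ f[L₂] --- qbar -----> P
```
where `fₖ : Lₖ → f[Lₖ]` is the restriction of `f` and `q_L` is induced by the inclusions
`Lₖ → L₀`. -/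
def IsInduced {S P : Frm.{u}} (f : L.ambient ⟶ S) (fbar : L.ambient ⟶ P) : Prop :=
  ∃ (C D : Frm.{u}) (i₁ : L.fstFrm ⟶ C) (i₂ : L.sndFrm ⟶ C)
    (j₁ : Frm.of (L.fst.map f.hom) ⟶ D) (j₂ : Frm.of (L.snd.map f.hom) ⟶ D)
    (hC : IsColimit (BinaryCofan.mk i₁ i₂)) (_ : IsColimit (BinaryCofan.mk j₁ j₂))
    (qbar : D ⟶ P),
    IsPushout
      (hC.desc (BinaryCofan.mk L.inclFst L.inclSnd))
      (hC.desc (BinaryCofan.mk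
        (Frm.ofHom (L.fst.mapRestrict f.hom) ≫ j₁)
        (Frm.ofHom (L.snd.mapRestrict f.hom) ≫ j₂)))
      fbar qbar

end BiFrm

/-! Everything reduces to congruences on `L₀`. Extremal epimorphisms of frames are the surjections,
so a sublocale is a kernel congruence, ordered by reverse inclusion.

For biframes, a homomorphism is monic as soon as it is injective on each of the two parts
separately. Hence (`BiFrm.extremalEpi_iff`) `f` is an extremal epimorphism iff it is surjective on
both parts and its kernel is generated, as a frame congruence, by the pairs lying in a common part
(`BiFrm.kerRel`). Subbilocales thus correspond to the congruences on `L₀` generated by such pairs.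
Joins of these congruences are again of this kind, which gives all meets of subbilocales, hence
completeness.

The pushout of `f₁ ⊕ f₂` along `q_L` is the quotient of `L₀` by `kerRel f` (`BiFrm.isPushout_proj`).
So `B_L` replaces a congruence by the one generated by its restriction to the parts. This is an
interior operator on congruences, hence a closure operator on sublocales, and its fixed points are
exactly the congruences that come from subbilocales. -/

/-! ## Quotients of frames -/

section FrameQuotients

variable {α β γ : Type u} [Order.Frame α] [Order.Frame β] [Order.Frame γ]

/-- The factorization of a frame homomorphism through a surjective one with a smaller kernel. -/
noncomputable def FrameHom.descend (g : FrameHom α β) (hg : Function.Surjective g)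
    (f : FrameHom α γ) (h : ∀ a b, g a = g b → f a = f b) : FrameHom β γ where
  toFun b := f (Function.surjInv hg b)
  map_inf' a b := by
    rw [← map_inf]
    exact h _ _ (by simp only [map_inf, Function.surjInv_eq])
  map_top' := by
    rw [← map_top f]
    exact h _ _ (by simp only [map_top, Function.surjInv_eq])
  map_sSup' s := by
    rw [← Set.image_image f, ← map_sSup]
    refine h _ _ ?_
    rw [Function.surjInv_eq hg, map_sSup, Set.image_image]
    simp only [Function.surjInv_eq, Set.image_id']

@[simp]
theorem FrameHom.descend_apply (g : FrameHom α β) (hg : Function.Surjective g)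
    (f : FrameHom α γ) (h : ∀ a b, g a = g b → f a = f b) (a : α) :
    g.descend hg f h (g a) = f a :=
  h _ _ (Function.surjInv_eq hg _)

/-- The sublocale of elements saturated for a relation `r`; it represents the quotient of the
frame by the congruence generated by `r`. -/
def Sublocale.ofRel (r : α → α → Prop) : Sublocale α where
  carrier := {x | ∀ a b, r a b → ∀ c, a ⊓ c ≤ x ↔ b ⊓ c ≤ x}
  sInf_mem' s hs a b hab c := by
    simp only [le_sInf_iff]
    exact forall₂_congr fun x hx => hs hx a b hab c
  -- Membership tests every `c`, that is, it closes `r` under meets; this is what gives stability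
  -- under `⇨`.
  himp_mem' x y hy a b hab c := by
    simp only [le_himp_iff, inf_assoc]
    exact hy a b hab _

theorem Sublocale.restrict_surjective (S : Sublocale α) : Function.Surjective S.restrict :=
  S.giRestrict.l_surjective

theorem Sublocale.restrict_ofRel_eq {r : α → α → Prop} {a b : α} (h : r a b) :
    (ofRel r).restrict a = (ofRel r).restrict b := by
  refine eq_of_forall_ge_iff fun x => ?_
  rw [(ofRel r).giRestrict.gc a x, (ofRel r).giRestrict.gc b x]
  simpa using x.2 a b h ⊤

/-- The right adjoint of `f` takes only saturated values when `f` respects `r`, so whether `f a ≤ y`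
depends only on the class of `a`. -/
theorem Sublocale.map_eq_of_restrict_ofRel_eq {r : α → α → Prop} (f : FrameHom α β)
    (hf : ∀ a b, r a b → f a = f b) {a b : α}
    (h : (ofRel r).restrict a = (ofRel r).restrict b) : f a = f b := by
  have gc : ∀ x y, f x ≤ y ↔ x ≤ sSup {z | f z ≤ y} := fun x y =>
    ⟨fun hx => le_sSup hx, fun hx => (OrderHomClass.mono f hx).trans (by
      rw [map_sSup]
      exact sSup_le (by rintro _ ⟨z, hz, rfl⟩; exact hz))⟩
  have mem : ∀ y, sSup {z | f z ≤ y} ∈ ofRel r := fun y c d hcd e => by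
    rw [← gc, ← gc, map_inf, map_inf, hf c d hcd]
  refine eq_of_forall_ge_iff fun y => ?_
  have key : ∀ c, f c ≤ y ↔ (ofRel r).restrict c ≤ ⟨_, mem y⟩ := fun c => by
    rw [gc, (ofRel r).giRestrict.gc c ⟨_, mem y⟩]
  rw [key, key, h]

/-- The homomorphism out of the quotient by `r` induced by a homomorphism that respects `r`. -/
noncomputable def Sublocale.liftOfRel {r : α → α → Prop} (f : FrameHom α β)
    (hf : ∀ a b, r a b → f a = f b) : FrameHom (ofRel r) β :=
  (ofRel r).restrict.descend (ofRel r).restrict_surjective f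
    fun _ _ => map_eq_of_restrict_ofRel_eq f hf

@[simp]
theorem Sublocale.liftOfRel_restrict {r : α → α → Prop} (f : FrameHom α β)
    (hf : ∀ a b, r a b → f a = f b) (a : α) :
    liftOfRel f hf ((ofRel r).restrict a) = f a :=
  FrameHom.descend_apply ..

end FrameQuotients

/-! ## Binary coproducts of frames -/

namespace FrameCoprod

variable {α β γ : Type u} [Order.Frame α] [Order.Frame β] [Order.Frame γ]

/-- The extension of a pair of frame homomorphisms to the frame of lower sets of the product. -/
def lowerSetLift (g : FrameHom α γ) (h : FrameHom β γ) : FrameHom (LowerSet (α × β)) γ where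
  toFun U := ⨆ p ∈ U, g p.1 ⊓ h p.2
  map_inf' U V := by
    refine le_antisymm (le_inf ?_ ?_) ?_
    · exact biSup_mono fun p hp => hp.1
    · exact biSup_mono fun p hp => hp.2
    · simp only [iSup_inf_eq, inf_iSup_eq]
      refine iSup₂_le fun q hq => iSup₂_le fun p hp => ?_
      -- For `p ∈ U` and `q ∈ V`, the meet `p ⊓ q` lies in both lower sets.
      refine le_trans (le_of_eq ?_) (le_iSup₂ (f := fun (p : α × β) (_ : p ∈ U ⊓ V) =>
        g p.1 ⊓ h p.2) (p ⊓ q) ⟨U.lower inf_le_left hp, V.lower inf_le_right hq⟩)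
      simp only [Prod.fst_inf, Prod.snd_inf, map_inf]
      ac_rfl
  map_top' := top_le_iff.1 (le_trans (by simp)
    (le_iSup₂ (f := fun (p : α × β) (_ : p ∈ (⊤ : LowerSet (α × β))) => g p.1 ⊓ h p.2) ⊤ trivial))
  map_sSup' s := by
    simp only [LowerSet.mem_sSup_iff, sSup_image, iSup_exists, iSup_and]
    rw [iSup_comm]
    refine iSup_congr fun U => ?_
    rw [iSup_comm]

theorem lowerSetLift_Iic (g : FrameHom α γ) (h : FrameHom β γ) (p : α × β) :
    lowerSetLift g h (LowerSet.Iic p) = g p.1 ⊓ h p.2 := by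
  refine le_antisymm (iSup₂_le fun q hq => ?_)
    (le_iSup₂ (f := fun (q : α × β) (_ : q ∈ LowerSet.Iic p) => g q.1 ⊓ h q.2) p
      (LowerSet.mem_Iic_iff.2 le_rfl))
  exact inf_le_inf (OrderHomClass.mono g hq.1) (OrderHomClass.mono h hq.2)

/-- The relations that make rectangles preserve joins in each coordinate. -/
inductive Rel : LowerSet (α × β) → LowerSet (α × β) → Prop
  -- The case `s = ∅` matters: it collapses rectangles with a bottom side to `⊥`.
  | left (s : Set α) (b : β) : Rel (LowerSet.Iic (sSup s, b)) (⨆ a ∈ s, LowerSet.Iic (a, b))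
  | right (a : α) (s : Set β) : Rel (LowerSet.Iic (a, sSup s)) (⨆ b ∈ s, LowerSet.Iic (a, b))

variable (α β) in
/-- The coproduct of two frames. -/
abbrev Carrier : Type u := Sublocale.ofRel (Rel (α := α) (β := β))

/-- The rectangle `a ⊕ b`. -/
def rect (a : α) (b : β) : Carrier α β := (Sublocale.ofRel Rel).restrict (LowerSet.Iic (a, b))

theorem rect_inf (a a' : α) (b b' : β) :
    rect (a ⊓ a') (b ⊓ b') = rect a b ⊓ rect a' b' := by
  rw [rect, rect, rect, ← map_inf, ← LowerSet.Iic_inf]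
  rfl

theorem rect_top : rect (⊤ : α) (⊤ : β) = ⊤ := by
  rw [rect, ← map_top (Sublocale.ofRel Rel).restrict]
  congr 1
  exact LowerSet.Iic_top

/-- The first coproduct injection. -/
def inl : FrameHom α (Carrier α β) where
  toFun a := rect a ⊤
  map_inf' a a' := by rw [← rect_inf, inf_top_eq]
  map_top' := rect_top
  map_sSup' s := by
    rw [sSup_image]
    exact (Sublocale.restrict_ofRel_eq (Rel.left s ⊤)).trans (by simp only [map_iSup]; rfl)

/-- The second coproduct injection. -/
def inr : FrameHom β (Carrier α β) where
  toFun b := rect ⊤ b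
  map_inf' b b' := by rw [← rect_inf, inf_top_eq]
  map_top' := rect_top
  map_sSup' s := by
    rw [sSup_image]
    exact (Sublocale.restrict_ofRel_eq (Rel.right ⊤ s)).trans (by simp only [map_iSup]; rfl)

theorem inl_inf_inr (a : α) (b : β) : inl a ⊓ inr b = rect a b := by
  change rect a ⊤ ⊓ rect ⊤ b = _
  rw [← rect_inf, inf_top_eq, top_inf_eq]

/-- The universal map out of the coproduct. -/
noncomputable def desc (g : FrameHom α γ) (h : FrameHom β γ) : FrameHom (Carrier α β) γ :=
  Sublocale.liftOfRel (lowerSetLift g h) (by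
    rintro _ _ (⟨s, b⟩ | ⟨a, s⟩)
    · simp only [map_iSup, lowerSetLift_Iic, map_sSup, sSup_image, iSup_inf_eq]
    · simp only [map_iSup, lowerSetLift_Iic, map_sSup, sSup_image, inf_iSup_eq])

theorem desc_rect (g : FrameHom α γ) (h : FrameHom β γ) (a : α) (b : β) :
    desc g h (rect a b) = g a ⊓ h b :=
  (Sublocale.liftOfRel_restrict ..).trans (lowerSetLift_Iic g h (a, b))

theorem desc_inl (g : FrameHom α γ) (h : FrameHom β γ) (a : α) : desc g h (inl a) = g a :=
  (desc_rect g h a ⊤).trans (by simp)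

theorem desc_inr (g : FrameHom α γ) (h : FrameHom β γ) (b : β) : desc g h (inr b) = h b :=
  (desc_rect g h ⊤ b).trans (by simp)

/-- A lower set is the join of its principal ones, so rectangles generate under joins, and each
rectangle is a meet of two injected elements. -/
theorem hom_ext {f g : FrameHom (Carrier α β) γ} (hl : ∀ a, f (inl a) = g (inl a))
    (hr : ∀ b, f (inr b) = g (inr b)) : f = g := by
  ext x
  obtain ⟨U, rfl⟩ := Sublocale.restrict_surjective _ x
  have hU : U = ⨆ p ∈ U, LowerSet.Iic p := by
    ext p
    simp only [SetLike.mem_coe, LowerSet.mem_iSup_iff, LowerSet.mem_Iic_iff, exists_prop]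
    exact ⟨fun hp => ⟨p, hp, le_rfl⟩, fun ⟨q, hq, hpq⟩ => U.lower hpq hq⟩
  rw [hU]
  simp only [map_iSup]
  refine iSup_congr fun p => iSup_congr fun _ => ?_
  have := inl_inf_inr p.1 p.2
  rw [rect] at this
  rw [← this, map_inf, map_inf, hl, hr]

end FrameCoprod

theorem Frm.exists_isColimit_binaryCofan (X Y : Frm.{u}) :
    ∃ (C : Frm.{u}) (i₁ : X ⟶ C) (i₂ : Y ⟶ C), Nonempty (IsColimit (BinaryCofan.mk i₁ i₂)) :=
  ⟨Frm.of (FrameCoprod.Carrier X Y), Frm.ofHom FrameCoprod.inl, Frm.ofHom FrameCoprod.inr,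
    ⟨BinaryCofan.isColimitMk (fun s => Frm.ofHom (FrameCoprod.desc s.inl.hom s.inr.hom))
      (fun s => by ext a; exact FrameCoprod.desc_inl _ _ a)
      (fun s => by ext a; exact FrameCoprod.desc_inr _ _ a)
      (fun s m hl hr => by
        refine Frm.hom_ext (FrameCoprod.hom_ext (fun a => ?_) fun a => ?_)
        · exact (ConcreteCategory.congr_hom hl a).trans (FrameCoprod.desc_inl _ _ a).symm
        · exact (ConcreteCategory.congr_hom hr a).trans (FrameCoprod.desc_inr _ _ a).symm)⟩⟩

/-! ## Extremal epimorphisms of frames -/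

namespace Frm

/-- The quotient of a frame by a relation. -/
def proj {X : Frm.{u}} (r : X → X → Prop) : X ⟶ Frm.of (Sublocale.ofRel r) :=
  Frm.ofHom (Sublocale.ofRel r).restrict

variable {X Y Z : Frm.{u}}

theorem proj_surjective (r : X → X → Prop) : Function.Surjective (proj r).hom :=
  Sublocale.restrict_surjective _

theorem proj_eq {r : X → X → Prop} {a b : X} (h : r a b) : (proj r).hom a = (proj r).hom b :=
  Sublocale.restrict_ofRel_eq h

theorem map_eq_of_proj_eq {r : X → X → Prop} (f : X ⟶ Y)
    (hf : ∀ a b, r a b → f.hom a = f.hom b) {a b : X}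
    (h : (proj r).hom a = (proj r).hom b) : f.hom a = f.hom b :=
  Sublocale.map_eq_of_restrict_ofRel_eq f.hom hf h

theorem exists_factor {g : X ⟶ Y} (hg : Function.Surjective g.hom) (f : X ⟶ Z)
    (h : ∀ a b, g.hom a = g.hom b → f.hom a = f.hom b) : ∃ k : Y ⟶ Z, g ≫ k = f :=
  ⟨Frm.ofHom (g.hom.descend hg f.hom h), by ext a; exact FrameHom.descend_apply g.hom hg f.hom h a⟩

theorem map_eq_of_factor {g : X ⟶ Y} {f : X ⟶ Z} {k : Y ⟶ Z} (hk : g ≫ k = f) {a b : X}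
    (h : g.hom a = g.hom b) : f.hom a = f.hom b := by
  rw [← hk]
  exact congrArg k.hom h

theorem epi_of_surjective {f : X ⟶ Y} (hf : Function.Surjective f.hom) : Epi f :=
  ConcreteCategory.epi_of_surjective f hf

theorem isIso_of_bijective {f : X ⟶ Y} (hf : Function.Bijective f.hom) : IsIso f := by
  obtain ⟨k, hk⟩ := exists_factor hf.2 (𝟙 X) fun a b h => hf.1 h
  have := epi_of_surjective hf.2
  exact ⟨k, hk, by rw [← cancel_epi f, reassoc_of% hk, Category.comp_id]⟩

/-- The kernel pair of a frame homomorphism, as a subframe of the product. -/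
def kerPair {α β : Type u} [Order.Frame α] [Order.Frame β] (f : FrameHom α β) :
    Subframe (α × α) where
  carrier := {p | f p.1 = f p.2}
  top_mem' := by simp
  inf_mem' p hp q hq := by
    simp only [Set.mem_ofPred_eq, Prod.fst_inf, Prod.snd_inf, map_inf] at hp hq ⊢
    rw [hp, hq]
  sSup_mem' s hs := by
    simp only [Set.mem_ofPred_eq, Prod.fst_sSup, Prod.snd_sSup, map_sSup, Set.image_image]
    exact congrArg sSup (Set.image_congr fun p hp => hs hp)

/-- The first projection of the kernel pair. -/
def kerPairFst {α β : Type u} [Order.Frame α] [Order.Frame β] (f : FrameHom α β) :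
    FrameHom (kerPair f) α where
  toFun p := p.1.1
  map_inf' _ _ := rfl
  map_top' := rfl
  map_sSup' s := by rw [Subframe.coe_sSup, Prod.fst_sSup, Set.image_image]

/-- The second projection of the kernel pair. -/
def kerPairSnd {α β : Type u} [Order.Frame α] [Order.Frame β] (f : FrameHom α β) :
    FrameHom (kerPair f) α where
  toFun p := p.1.2
  map_inf' _ _ := rfl
  map_top' := rfl
  map_sSup' s := by rw [Subframe.coe_sSup, Prod.snd_sSup, Set.image_image]

/-- The kernel pair is itself a frame, and `f` equalizes its two projections. -/
theorem injective_of_mono (f : X ⟶ Y) [Mono f] : Function.Injective f.hom := fun a b h => by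
  have : Frm.ofHom (kerPairFst f.hom) = Frm.ofHom (kerPairSnd f.hom) := by
    rw [← cancel_mono f]
    ext p
    exact p.2
  exact ConcreteCategory.congr_hom this ⟨(a, b), h⟩

/-- Through the quotient by its kernel, `f` factors with an injective, hence monic, second factor,
which extremality makes an isomorphism. Conversely, a mono through which a surjection factors is
bijective. -/
theorem extremalEpi_iff_surjective {f : X ⟶ Y} :
    ExtremalEpi f ↔ Function.Surjective f.hom := by
  constructor
  · intro hf
    obtain ⟨k, hk⟩ := exists_factor (proj_surjective fun a b => f.hom a = f.hom b) f
      fun a b => map_eq_of_proj_eq f fun _ _ h => h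
    have hinj : Function.Injective k.hom := by
      intro x y hxy
      obtain ⟨a, rfl⟩ := proj_surjective _ x
      obtain ⟨b, rfl⟩ := proj_surjective _ y
      refine proj_eq ?_
      rw [← hk]
      exact hxy
    have : Mono k := ConcreteCategory.mono_of_injective k hinj
    have : IsIso k := ExtremalEpi.isIso f _ k hk
    rw [← hk]
    exact (ConcreteCategory.bijective_of_isIso k).2.comp (proj_surjective _)
  · intro hf
    exact
      { toEpi := epi_of_surjective hf
        isIso := fun p i hpi _ => isIso_of_bijective ⟨injective_of_mono i, fun y => by
          obtain ⟨x, rfl⟩ := hf y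
          exact ⟨p.hom x, ConcreteCategory.congr_hom hpi x⟩⟩ }

theorem extremalQuot_le_iff {F G : ExtremalQuot X} :
    F ≤ G ↔ ∀ a b, G.hom.hom a = G.hom.hom b → F.hom.hom a = F.hom.hom b :=
  ⟨fun ⟨_, hk⟩ _ _ => map_eq_of_factor hk,
    exists_factor (extremalEpi_iff_surjective.1 G.ext) F.hom⟩

end Frm

/-! ## Extremal epimorphisms of biframes -/

namespace Subframe

variable {α β : Type u} [Order.Frame α] [Order.Frame β]

theorem bot_mem (A : Subframe α) : (⊥ : α) ∈ A := by
  rw [← sSup_empty]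
  exact A.sSup_mem' ∅ (Set.empty_subset _)

theorem mem_map_of_mem (f : FrameHom α β) (A : Subframe α) {a : α} (ha : a ∈ A) :
    f a ∈ A.map f := ⟨a, ha, rfl⟩

theorem mapRestrict_surjective (f : FrameHom α β) (A : Subframe α) :
    Function.Surjective (A.mapRestrict f) := by
  rintro ⟨_, a, ha, rfl⟩
  exact ⟨⟨a, ha⟩, rfl⟩

variable (α) in
/-- The whole frame as a subframe. -/
def whole : Subframe α where
  carrier := Set.univ
  top_mem' := trivial
  inf_mem' _ _ _ _ := trivial
  sSup_mem' _ _ := trivial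

variable (α) in
/-- The least subframe. -/
def least : Subframe α where
  carrier := {a | a = ⊥ ∨ a = ⊤}
  top_mem' := Or.inr rfl
  inf_mem' := by
    rintro a (rfl | rfl) b hb
    · exact Or.inl (bot_inf_eq b)
    · rwa [top_inf_eq]
  sSup_mem' s hs := by
    by_cases h : ⊤ ∈ s
    · exact Or.inr (top_le_iff.1 (le_sSup h))
    · refine Or.inl (sSup_eq_bot.2 fun a ha => (hs ha).resolve_right ?_)
      rintro rfl
      exact h ha

theorem map_mem_of_mem_least (f : FrameHom α β) (A : Subframe β) {a : α} (ha : a ∈ least α) :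
    f a ∈ A := by
  obtain rfl | rfl := ha
  · rw [map_bot]
    exact A.bot_mem
  · rw [map_top]
    exact A.top_mem

end Subframe

namespace BiFrm

variable {L M N : BiFrm.{u}}

theorem frameHom_ext {α : Type u} [Order.Frame α] {f g : FrameHom L.ambient α}
    (h₁ : ∀ a ∈ L.fst, f a = g a) (h₂ : ∀ a ∈ L.snd, f a = g a) : f = g := by
  ext x
  obtain ⟨B, hB, rfl⟩ := L.subbasis x
  rw [map_sSup, map_sSup]
  refine congrArg sSup (Set.image_congr fun b hb => ?_)
  obtain ⟨F, hF, rfl⟩ := hB b hb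
  rw [map_finset_inf, map_finset_inf]
  exact Finset.inf_congr rfl fun a ha => (hF ha).elim (h₁ a) (h₂ a)

theorem hom_ext {f g : L ⟶ M} (h₁ : ∀ a ∈ L.fst, f.base.hom a = g.base.hom a)
    (h₂ : ∀ a ∈ L.snd, f.base.hom a = g.base.hom a) : f = g :=
  Hom.ext (Frm.hom_ext (frameHom_ext h₁ h₂))

/-- The biframe `(X, X, 2)`. -/
def ofFst (X : Frm.{u}) : BiFrm.{u} where
  ambient := X
  fst := Subframe.whole X
  snd := Subframe.least X
  subbasis x := ⟨{x}, fun b _ => ⟨{b}, fun _ _ => Or.inl trivial, by simp⟩, by simp⟩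

/-- The biframe `(X, 2, X)`. -/
def ofSnd (X : Frm.{u}) : BiFrm.{u} where
  ambient := X
  fst := Subframe.least X
  snd := Subframe.whole X
  subbasis x := ⟨{x}, fun b _ => ⟨{b}, fun _ _ => Or.inr trivial, by simp⟩, by simp⟩

/-- The morphism out of `(X, X, 2)` induced by a frame homomorphism into the first component. -/
def ofFstHom {X : Frm.{u}} (f : X ⟶ L.fstFrm) : ofFst X ⟶ L where
  base := f ≫ L.inclFst
  map_fst _ _ := (f.hom _).2
  map_snd _ ha := Subframe.map_mem_of_mem_least (f ≫ L.inclFst).hom L.snd ha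

/-- The morphism out of `(X, 2, X)` induced by a frame homomorphism into the second component. -/
def ofSndHom {X : Frm.{u}} (f : X ⟶ L.sndFrm) : ofSnd X ⟶ L where
  base := f ≫ L.inclSnd
  map_fst _ ha := Subframe.map_mem_of_mem_least (f ≫ L.inclSnd).hom L.fst ha
  map_snd _ _ := (f.hom _).2

/-- The test object is `(X, X, 2)` with `X` the kernel pair of `m` on `L₁`; its second part imposes
no condition on maps out of it. -/
theorem injOn_fst_of_mono (m : L ⟶ M) [Mono m] {a b : L.ambient} (ha : a ∈ L.fst)
    (hb : b ∈ L.fst) (h : m.base.hom a = m.base.hom b) : a = b := by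
  let k := m.base.hom.comp L.fst.subtype
  have : ofFstHom (L := L) (Frm.ofHom (Frm.kerPairFst k)) =
      ofFstHom (Frm.ofHom (Frm.kerPairSnd k)) := by
    rw [← cancel_mono m]
    refine Hom.ext ?_
    ext p
    exact p.2
  exact ConcreteCategory.congr_hom (congrArg Hom.base this) ⟨(⟨a, ha⟩, ⟨b, hb⟩), h⟩

theorem injOn_snd_of_mono (m : L ⟶ M) [Mono m] {a b : L.ambient} (ha : a ∈ L.snd)
    (hb : b ∈ L.snd) (h : m.base.hom a = m.base.hom b) : a = b := by
  let k := m.base.hom.comp L.snd.subtype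
  have : ofSndHom (L := L) (Frm.ofHom (Frm.kerPairFst k)) =
      ofSndHom (Frm.ofHom (Frm.kerPairSnd k)) := by
    rw [← cancel_mono m]
    refine Hom.ext ?_
    ext p
    exact p.2
  exact ConcreteCategory.congr_hom (congrArg Hom.base this) ⟨(⟨a, ha⟩, ⟨b, hb⟩), h⟩

/-- Homomorphisms are determined on the parts, so `m` need not be injective on `L₀`. This is why
extremality in biframes demands more than surjectivity. -/
theorem mono_of_injOn (m : L ⟶ M)
    (h₁ : ∀ a ∈ L.fst, ∀ b ∈ L.fst, m.base.hom a = m.base.hom b → a = b)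
    (h₂ : ∀ a ∈ L.snd, ∀ b ∈ L.snd, m.base.hom a = m.base.hom b → a = b) : Mono m where
  right_cancellation f g h := by
    have h' : ∀ a, m.base.hom (f.base.hom a) = m.base.hom (g.base.hom a) :=
      fun a => ConcreteCategory.congr_hom (congrArg Hom.base h) a
    exact hom_ext
      (fun a ha => h₁ _ (f.map_fst a ha) _ (g.map_fst a ha) (h' a))
      (fun a ha => h₂ _ (f.map_snd a ha) _ (g.map_snd a ha) (h' a))

variable (L) in
/-- Two elements lie in a common component of `L`. -/
def SamePart (a b : L.ambient) : Prop := (a ∈ L.fst ∧ b ∈ L.fst) ∨ (a ∈ L.snd ∧ b ∈ L.snd)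

variable (L) in
/-- The restriction of the kernel of a frame homomorphism to the two components of `L`. -/
def kerRel {S : Frm.{u}} (f : L.ambient ⟶ S) (a b : L.ambient) : Prop :=
  L.SamePart a b ∧ f.hom a = f.hom b

variable (L) in
/-- The quotient biframe on the codomain of a surjective frame homomorphism. -/
def image {P : Frm.{u}} (p : L.ambient ⟶ P) (hp : Function.Surjective p.hom) : BiFrm.{u} where
  ambient := P
  fst := L.fst.map p.hom
  snd := L.snd.map p.hom
  subbasis x := by
    classical
    obtain ⟨y, rfl⟩ := hp x
    obtain ⟨B, hB, rfl⟩ := L.subbasis y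
    refine ⟨p.hom '' B, ?_, map_sSup ..⟩
    rintro _ ⟨b, hb, rfl⟩
    obtain ⟨F, hF, rfl⟩ := hB b hb
    refine ⟨F.image p.hom, ?_, ?_⟩
    · rw [Finset.coe_image]
      rintro _ ⟨a, ha, rfl⟩
      exact (hF ha).imp (Subframe.mem_map_of_mem _ _) (Subframe.mem_map_of_mem _ _)
    · rw [map_finset_inf, Finset.inf_image]
      rfl

variable (L) in
/-- The quotient morphism onto `L.image p hp`. -/
def toImage {P : Frm.{u}} (p : L.ambient ⟶ P) (hp : Function.Surjective p.hom) :
    L ⟶ L.image p hp where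
  base := p
  map_fst _ ha := Subframe.mem_map_of_mem _ _ ha
  map_snd _ ha := Subframe.mem_map_of_mem _ _ ha

/-- Both components of a biframe homomorphism are surjective. -/
def Hom.IsPartSurjective (f : L ⟶ M) : Prop :=
  (∀ b ∈ M.fst, ∃ a ∈ L.fst, f.base.hom a = b) ∧ ∀ b ∈ M.snd, ∃ a ∈ L.snd, f.base.hom a = b

theorem toImage_isPartSurjective {P : Frm.{u}} (p : L.ambient ⟶ P)
    (hp : Function.Surjective p.hom) : Hom.IsPartSurjective (L.toImage p hp) :=
  ⟨fun _ h => h, fun _ h => h⟩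

/-- The range is a subframe containing both parts, which generate. -/
theorem Hom.IsPartSurjective.surjective {f : L ⟶ M} (hf : Hom.IsPartSurjective f) :
    Function.Surjective f.base.hom := by
  classical
  intro x
  suffices h : x ∈ (Subframe.whole L.ambient).map f.base.hom by
    obtain ⟨a, -, rfl⟩ := h
    exact ⟨a, rfl⟩
  obtain ⟨B, hB, rfl⟩ := M.subbasis x
  refine Subframe.sSup_mem' _ _ fun b hb => ?_
  obtain ⟨F, hF, rfl⟩ := hB b hb
  refine Finset.inf_induction (p := (· ∈ (Subframe.whole L.ambient).map f.base.hom))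
    (Subframe.top_mem _) (fun a ha b hb => Subframe.inf_mem _ ha hb) fun b hb => ?_
  obtain h | h := hF hb
  · obtain ⟨a, -, rfl⟩ := hf.1 b h
    exact ⟨a, trivial, rfl⟩
  · obtain ⟨a, -, rfl⟩ := hf.2 b h
    exact ⟨a, trivial, rfl⟩

theorem exists_factor {f : L ⟶ M} (hf : Hom.IsPartSurjective f) (g : L ⟶ N)
    (h : ∀ a b, f.base.hom a = f.base.hom b → g.base.hom a = g.base.hom b) :
    ∃ k : M ⟶ N, f ≫ k = g := by
  obtain ⟨k, hk⟩ := Frm.exists_factor hf.surjective g.base h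
  have hk' : ∀ a, k.hom (f.base.hom a) = g.base.hom a := ConcreteCategory.congr_hom hk
  refine ⟨⟨k, fun b hb => ?_, fun b hb => ?_⟩, Hom.ext hk⟩
  · obtain ⟨a, ha, rfl⟩ := hf.1 b hb
    rw [hk']
    exact g.map_fst a ha
  · obtain ⟨a, ha, rfl⟩ := hf.2 b hb
    rw [hk']
    exact g.map_snd a ha

theorem Hom.IsPartSurjective.epi {f : L ⟶ M} (hf : Hom.IsPartSurjective f) : Epi f where
  left_cancellation g h e := by
    have := Frm.epi_of_surjective hf.surjective
    exact Hom.ext ((cancel_epi f.base).1 (congrArg Hom.base e))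

theorem Hom.IsPartSurjective.isIso {f : L ⟶ M} (hf : Hom.IsPartSurjective f)
    (hinj : Function.Injective f.base.hom) : IsIso f := by
  obtain ⟨k, hk⟩ := exists_factor hf (𝟙 L) fun a b h => hinj h
  have := hf.epi
  exact ⟨k, hk, by rw [← cancel_epi f, reassoc_of% hk, Category.comp_id]⟩

/-- The quotient by `kerRel` is the largest one forced by any factorization of `f` through a mono,
since monos are exactly the maps injective on both parts. -/
theorem extremalEpi_iff {f : L ⟶ M} :
    ExtremalEpi f ↔ Hom.IsPartSurjective f ∧ ∀ a b, f.base.hom a = f.base.hom b →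
      (Frm.proj (L.kerRel f.base)).hom a = (Frm.proj (L.kerRel f.base)).hom b := by
  constructor
  · intro hf
    let p := L.toImage (Frm.proj (L.kerRel f.base)) (Frm.proj_surjective _)
    obtain ⟨k, hk⟩ := exists_factor (toImage_isPartSurjective _ _ : Hom.IsPartSurjective p) f
      fun a b => Frm.map_eq_of_proj_eq f.base fun _ _ h => h.2
    have hk' : ∀ a, k.base.hom (p.base.hom a) = f.base.hom a :=
      ConcreteCategory.congr_hom (congrArg Hom.base hk)
    have : Mono k := by
      refine mono_of_injOn k ?_ ?_
      · rintro _ ⟨a, ha, rfl⟩ _ ⟨b, hb, rfl⟩ h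
        exact Frm.proj_eq ⟨Or.inl ⟨ha, hb⟩, (hk' a).symm.trans (h.trans (hk' b))⟩
      · rintro _ ⟨a, ha, rfl⟩ _ ⟨b, hb, rfl⟩ h
        exact Frm.proj_eq ⟨Or.inr ⟨ha, hb⟩, (hk' a).symm.trans (h.trans (hk' b))⟩
    have : IsIso k := ExtremalEpi.isIso f p k hk
    have hinv : f ≫ inv k = p := by rw [IsIso.comp_inv_eq, hk]
    have hkinv : ∀ b, k.base.hom ((inv k).base.hom b) = b :=
      ConcreteCategory.congr_hom (congrArg Hom.base (IsIso.inv_hom_id k))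
    refine ⟨⟨fun b hb => ?_, fun b hb => ?_⟩, fun a b =>
      Frm.map_eq_of_factor (congrArg Hom.base hinv)⟩
    · obtain ⟨a, ha, hab⟩ := (inv k).map_fst b hb
      refine ⟨a, ha, ?_⟩
      rw [← hkinv b, ← hab]
      exact (hk' a).symm
    · obtain ⟨a, ha, hab⟩ := (inv k).map_snd b hb
      refine ⟨a, ha, ?_⟩
      rw [← hkinv b, ← hab]
      exact (hk' a).symm
  · rintro ⟨hf, hker⟩
    refine { toEpi := hf.epi, isIso := fun {K} g m hgm _ => ?_ }
    have hgm' : ∀ a, m.base.hom (g.base.hom a) = f.base.hom a :=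
      ConcreteCategory.congr_hom (congrArg Hom.base hgm)
    have hg : Hom.IsPartSurjective g := by
      refine ⟨fun b hb => ?_, fun b hb => ?_⟩
      · obtain ⟨a, ha, hab⟩ := hf.1 _ (m.map_fst b hb)
        exact ⟨a, ha, injOn_fst_of_mono m (g.map_fst a ha) hb ((hgm' a).trans hab)⟩
      · obtain ⟨a, ha, hab⟩ := hf.2 _ (m.map_snd b hb)
        exact ⟨a, ha, injOn_snd_of_mono m (g.map_snd a ha) hb ((hgm' a).trans hab)⟩
    have hm : Hom.IsPartSurjective m := by
      refine ⟨fun b hb => ?_, fun b hb => ?_⟩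
      · obtain ⟨a, ha, rfl⟩ := hf.1 b hb
        exact ⟨_, g.map_fst a ha, hgm' a⟩
      · obtain ⟨a, ha, rfl⟩ := hf.2 b hb
        exact ⟨_, g.map_snd a ha, hgm' a⟩
    refine hm.isIso fun x y hxy => ?_
    obtain ⟨a, rfl⟩ := hg.surjective x
    obtain ⟨b, rfl⟩ := hg.surjective y
    rw [hgm', hgm'] at hxy
    -- Since the generating pairs lie in a common part, injectivity of `m` on the parts makes `g`
    -- identify them.
    refine Frm.map_eq_of_proj_eq g.base (fun c d hcd => ?_) (hker a b hxy)
    have e : m.base.hom (g.base.hom c) = m.base.hom (g.base.hom d) := by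
      rw [hgm', hgm', hcd.2]
    obtain ⟨hc, hd⟩ | ⟨hc, hd⟩ := hcd.1
    · exact injOn_fst_of_mono m (g.map_fst c hc) (g.map_fst d hd) e
    · exact injOn_snd_of_mono m (g.map_snd c hc) (g.map_snd d hd) e

theorem extremalEpi_base {f : L ⟶ M} (hf : ExtremalEpi f) : ExtremalEpi f.base :=
  Frm.extremalEpi_iff_surjective.2 (extremalEpi_iff.1 hf).1.surjective

/-- The kernel is generated by `r`, whose pairs already belong to the `kerRel` of the projection. -/
theorem extremalEpi_toImage {r : L.ambient → L.ambient → Prop}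
    (hr : ∀ a b, r a b → L.SamePart a b) :
    ExtremalEpi (L.toImage (Frm.proj r) (Frm.proj_surjective r)) :=
  extremalEpi_iff.2 ⟨toImage_isPartSurjective _ _, fun _ _ =>
    Frm.map_eq_of_proj_eq _ fun a b hab => Frm.proj_eq ⟨hr a b hab, Frm.proj_eq hab⟩⟩

theorem extremalQuot_le_iff {F G : ExtremalQuot L} :
    F ≤ G ↔ ∀ a b, G.hom.base.hom a = G.hom.base.hom b → F.hom.base.hom a = F.hom.base.hom b :=
  ⟨fun ⟨_, hk⟩ _ _ => Frm.map_eq_of_factor (congrArg Hom.base hk),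
    exists_factor (extremalEpi_iff.1 G.ext).1 F.hom⟩

/-! ## Completeness of the poset of subbilocales -/

/-- The meet is the quotient by the union of all the relations `kerRel F`; these generate the full
kernels because each `F` is extremal. -/
theorem exists_isGLB (A : Set (ExtSub L)) : ∃ i, IsGLB A i := by
  let r : L.ambient → L.ambient → Prop := fun a b =>
    ∃ F : ExtremalQuot L, toAntisymmetrization (· ≤ ·) F ∈ A ∧ L.kerRel F.hom.base a b
  refine ⟨ExtSub.mk _ (extremalEpi_toImage (r := r) fun a b ⟨_, _, h⟩ => h.1), ?_, ?_⟩
  · intro x hx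
    induction x using Antisymmetrization.induction_on with | _ F
    refine toAntisymmetrization_le_toAntisymmetrization_iff.2 (extremalQuot_le_iff.2 ?_)
    intro a b hab
    exact Frm.map_eq_of_proj_eq (Frm.proj r) (fun c d hcd => Frm.proj_eq ⟨F, hx, hcd⟩)
      ((extremalEpi_iff.1 F.ext).2 a b hab)
  · intro x hx
    induction x using Antisymmetrization.induction_on with | _ G
    refine toAntisymmetrization_le_toAntisymmetrization_iff.2 (extremalQuot_le_iff.2 ?_)
    intro a b
    refine Frm.map_eq_of_proj_eq G.hom.base ?_
    rintro c d ⟨F, hF, hcd⟩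
    exact extremalQuot_le_iff.1 (toAntisymmetrization_le_toAntisymmetrization_iff.1 (hx hF))
      c d hcd.2

theorem exists_isLUB (A : Set (ExtSub L)) : ∃ s, IsLUB A s :=
  (exists_isGLB (upperBounds A)).imp fun _ => isGLB_upperBounds.1

/-! ## The induced quotient -/

/-- As `f₁` and `f₂` are surjective, a cocone amounts to a map out of `L₀` whose restriction to each
part factors through `fₖ`, that is, a map respecting `kerRel f`. -/
theorem isPushout_proj {S C D : Frm.{u}} (f : L.ambient ⟶ S) {i₁ : L.fstFrm ⟶ C}
    {i₂ : L.sndFrm ⟶ C} {j₁ : Frm.of (L.fst.map f.hom) ⟶ D} {j₂ : Frm.of (L.snd.map f.hom) ⟶ D}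
    (hC : IsColimit (BinaryCofan.mk i₁ i₂)) (hD : IsColimit (BinaryCofan.mk j₁ j₂))
    {q : C ⟶ L.ambient} {φ : C ⟶ D} (hq₁ : i₁ ≫ q = L.inclFst) (hq₂ : i₂ ≫ q = L.inclSnd)
    (hφ₁ : i₁ ≫ φ = Frm.ofHom (L.fst.mapRestrict f.hom) ≫ j₁)
    (hφ₂ : i₂ ≫ φ = Frm.ofHom (L.snd.mapRestrict f.hom) ≫ j₂) :
    ∃ w : D ⟶ Frm.of (Sublocale.ofRel (L.kerRel f)),
      IsPushout q φ (Frm.proj (L.kerRel f)) w := by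
  let f₁ : L.fstFrm ⟶ Frm.of (L.fst.map f.hom) := Frm.ofHom (L.fst.mapRestrict f.hom)
  let f₂ : L.sndFrm ⟶ Frm.of (L.snd.map f.hom) := Frm.ofHom (L.snd.mapRestrict f.hom)
  have hf₁ : Function.Surjective f₁.hom := L.fst.mapRestrict_surjective f.hom
  have hf₂ : Function.Surjective f₂.hom := L.snd.mapRestrict_surjective f.hom
  have : Epi f₁ := Frm.epi_of_surjective hf₁
  have : Epi f₂ := Frm.epi_of_surjective hf₂
  let p := Frm.proj (L.kerRel f)
  have : Epi p := Frm.epi_of_surjective (Frm.proj_surjective _)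
  obtain ⟨w₁, hw₁⟩ := Frm.exists_factor hf₁ (L.inclFst ≫ p) fun a b h =>
    Frm.proj_eq ⟨Or.inl ⟨a.2, b.2⟩, congrArg Subtype.val h⟩
  obtain ⟨w₂, hw₂⟩ := Frm.exists_factor hf₂ (L.inclSnd ≫ p) fun a b h =>
    Frm.proj_eq ⟨Or.inr ⟨a.2, b.2⟩, congrArg Subtype.val h⟩
  let w : D ⟶ Frm.of (Sublocale.ofRel (L.kerRel f)) := hD.desc (BinaryCofan.mk w₁ w₂)
  have hj₁ : j₁ ≫ w = w₁ := hD.fac _ ⟨.left⟩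
  have hj₂ : j₂ ≫ w = w₂ := hD.fac _ ⟨.right⟩
  have comm : q ≫ p = φ ≫ w := by
    refine BinaryCofan.IsColimit.hom_ext hC ?_ ?_
    · change i₁ ≫ q ≫ p = i₁ ≫ φ ≫ w
      rw [reassoc_of% hq₁, reassoc_of% hφ₁, hj₁, hw₁]
    · change i₂ ≫ q ≫ p = i₂ ≫ φ ≫ w
      rw [reassoc_of% hq₂, reassoc_of% hφ₂, hj₂, hw₂]
  have lift : ∀ s : PushoutCocone q φ, ∃ k, p ≫ k = s.inl ∧ w ≫ k = s.inr := by
    intro s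
    have hs₁ : L.inclFst ≫ s.inl = f₁ ≫ j₁ ≫ s.inr := by
      rw [← reassoc_of% hφ₁, ← s.condition, reassoc_of% hq₁]
    have hs₂ : L.inclSnd ≫ s.inl = f₂ ≫ j₂ ≫ s.inr := by
      rw [← reassoc_of% hφ₂, ← s.condition, reassoc_of% hq₂]
    obtain ⟨k, hk⟩ := Frm.exists_factor (Frm.proj_surjective (L.kerRel f)) s.inl fun a b =>
      Frm.map_eq_of_proj_eq s.inl (by
        rintro c d ⟨⟨hc, hd⟩ | ⟨hc, hd⟩, hcd⟩
        · have e : f₁.hom ⟨c, hc⟩ = f₁.hom ⟨d, hd⟩ := Subtype.ext hcd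
          exact Frm.map_eq_of_factor hs₁.symm e
        · have e : f₂.hom ⟨c, hc⟩ = f₂.hom ⟨d, hd⟩ := Subtype.ext hcd
          exact Frm.map_eq_of_factor hs₂.symm e)
    refine ⟨k, hk, BinaryCofan.IsColimit.hom_ext hD ?_ ?_⟩
    · change j₁ ≫ w ≫ k = j₁ ≫ s.inr
      rw [reassoc_of% hj₁, ← cancel_epi f₁, reassoc_of% hw₁, ← hs₁]
      exact congrArg (L.inclFst ≫ ·) hk
    · change j₂ ≫ w ≫ k = j₂ ≫ s.inr
      rw [reassoc_of% hj₂, ← cancel_epi f₂, reassoc_of% hw₂, ← hs₂]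
      exact congrArg (L.inclSnd ≫ ·) hk
  choose k hk₁ hk₂ using lift
  exact ⟨w, ⟨comm⟩, ⟨PushoutCocone.IsColimit.mk comm k hk₁ hk₂ fun s m hm _ => 
    (cancel_epi p).1 (hm.trans (hk₁ s).symm)⟩⟩

theorem isInduced_proj {S : Frm.{u}} (f : L.ambient ⟶ S) :
    L.IsInduced f (Frm.proj (L.kerRel f)) := by
  obtain ⟨C, i₁, i₂, ⟨hC⟩⟩ := Frm.exists_isColimit_binaryCofan L.fstFrm L.sndFrm
  obtain ⟨D, j₁, j₂, ⟨hD⟩⟩ := Frm.exists_isColimit_binaryCofan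
    (Frm.of (L.fst.map f.hom)) (Frm.of (L.snd.map f.hom))
  obtain ⟨w, hw⟩ := isPushout_proj f hC hD (hC.fac (BinaryCofan.mk L.inclFst L.inclSnd) ⟨.left⟩)
    (hC.fac (BinaryCofan.mk L.inclFst L.inclSnd) ⟨.right⟩)
    (hC.fac (BinaryCofan.mk (Frm.ofHom (L.fst.mapRestrict f.hom) ≫ j₁)
      (Frm.ofHom (L.snd.mapRestrict f.hom) ≫ j₂)) ⟨.left⟩)
    (hC.fac (BinaryCofan.mk (Frm.ofHom (L.fst.mapRestrict f.hom) ≫ j₁)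
      (Frm.ofHom (L.snd.mapRestrict f.hom) ≫ j₂)) ⟨.right⟩)
  exact ⟨C, D, i₁, i₂, j₁, j₂, hC, hD, w, hw⟩

/-- Uniqueness of pushouts makes `⟨f̄⟩` independent of the chosen coproducts and pushout. -/
theorem IsInduced.exists_iso {S P : Frm.{u}} {f : L.ambient ⟶ S} {fbar : L.ambient ⟶ P}
    (h : L.IsInduced f fbar) :
    ∃ e : Frm.of (Sublocale.ofRel (L.kerRel f)) ≅ P, Frm.proj (L.kerRel f) ≫ e.hom = fbar := by
  obtain ⟨C, D, i₁, i₂, j₁, j₂, hC, hD, qbar, hq⟩ := h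
  obtain ⟨w, hw⟩ := isPushout_proj f hC hD (hC.fac (BinaryCofan.mk L.inclFst L.inclSnd) ⟨.left⟩)
    (hC.fac (BinaryCofan.mk L.inclFst L.inclSnd) ⟨.right⟩)
    (hC.fac (BinaryCofan.mk (Frm.ofHom (L.fst.mapRestrict f.hom) ≫ j₁)
      (Frm.ofHom (L.snd.mapRestrict f.hom) ≫ j₂)) ⟨.left⟩)
    (hC.fac (BinaryCofan.mk (Frm.ofHom (L.fst.mapRestrict f.hom) ≫ j₁)
      (Frm.ofHom (L.snd.mapRestrict f.hom) ≫ j₂)) ⟨.right⟩)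
  exact ⟨IsPushout.isoIsPushout _ _ hw hq, IsPushout.inl_isoIsPushout_hom _ _ hw hq⟩

theorem IsInduced.extremalEpi {S P : Frm.{u}} {f : L.ambient ⟶ S} {fbar : L.ambient ⟶ P}
    (h : L.IsInduced f fbar) : ExtremalEpi fbar := by
  obtain ⟨e, rfl⟩ := h.exists_iso
  exact Frm.extremalEpi_iff_surjective.2
    ((ConcreteCategory.bijective_of_isIso e.hom).2.comp (Frm.proj_surjective _))

variable (L) in
/-- The map `f ↦ f̄` on extremal epimorphisms out of `L₀`. -/
def inducedHom : ExtremalQuot L.ambient →o ExtremalQuot L.ambient where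
  toFun F := ⟨_, Frm.proj (L.kerRel F.hom),
    Frm.extremalEpi_iff_surjective.2 (Frm.proj_surjective _)⟩
  monotone' _ _ h := Frm.extremalQuot_le_iff.2 fun _ _ => Frm.map_eq_of_proj_eq _ fun c d hcd =>
    Frm.proj_eq ⟨hcd.1, Frm.extremalQuot_le_iff.1 h c d hcd.2⟩

theorem le_inducedHom (F : ExtremalQuot L.ambient) : F ≤ L.inducedHom F :=
  Frm.extremalQuot_le_iff.2 fun _ _ => Frm.map_eq_of_proj_eq _ fun _ _ hcd => hcd.2

/-- The quotient by `kerRel f` still identifies every pair of `kerRel f`, so restricting its kernel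
to the parts loses no generator. -/
theorem inducedHom_inducedHom_le (F : ExtremalQuot L.ambient) :
    L.inducedHom (L.inducedHom F) ≤ L.inducedHom F :=
  Frm.extremalQuot_le_iff.2 fun _ _ => Frm.map_eq_of_proj_eq _ fun _ _ hcd =>
    Frm.proj_eq ⟨hcd.1, Frm.proj_eq hcd⟩

variable (L) in
/-- The closure operator `⟨f⟩ ↦ ⟨f̄⟩` on the sublocales of `L₀`. -/
def inducedClosure : ClosureOperator (ExtSub L.ambient) :=
  ClosureOperator.mk' L.inducedHom.antisymmetrization L.inducedHom.antisymmetrization.monotone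
    (fun x => by
      induction x using Antisymmetrization.induction_on with | _ F
      exact toAntisymmetrization_le_toAntisymmetrization_iff.2 (le_inducedHom F))
    (fun x => by
      induction x using Antisymmetrization.induction_on with | _ F
      exact toAntisymmetrization_le_toAntisymmetrization_iff.2 (inducedHom_inducedHom_le F))

theorem inducedClosure_eq {S P : Frm.{u}} {f : L.ambient ⟶ S} {fbar : L.ambient ⟶ P}
    (hf : ExtremalEpi f) (hfbar : ExtremalEpi fbar) (h : L.IsInduced f fbar) :
    L.inducedClosure (ExtSub.mk f hf) = ExtSub.mk fbar hfbar := by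
  obtain ⟨e, rfl⟩ := h.exists_iso
  have he : (Frm.proj (L.kerRel f) ≫ e.hom) ≫ e.inv = Frm.proj (L.kerRel f) := by simp
  exact le_antisymm
    (toAntisymmetrization_le_toAntisymmetrization_iff.2 ⟨e.inv, he⟩)
    (toAntisymmetrization_le_toAntisymmetrization_iff.2 ⟨e.hom, rfl⟩)

/-! ## Subbilocales as fixed points -/

variable (L) in
/-- The map `f ↦ f₀` on extremal epimorphisms out of `L`. -/
def baseHom : ExtremalQuot L →o ExtremalQuot L.ambient where
  toFun F := ⟨_, F.hom.base, extremalEpi_base F.ext⟩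
  monotone' _ _ h := Frm.extremalQuot_le_iff.2 (extremalQuot_le_iff.1 h)

/-- Being fixed is precisely the kernel condition in `extremalEpi_iff`. -/
theorem inducedClosure_baseHom (x : ExtSub L) :
    L.inducedClosure (L.baseHom.antisymmetrization x) = L.baseHom.antisymmetrization x := by
  induction x using Antisymmetrization.induction_on with | _ F
  exact le_antisymm (toAntisymmetrization_le_toAntisymmetrization_iff.2
    (Frm.extremalQuot_le_iff.2 (extremalEpi_iff.1 F.ext).2))
    (L.inducedClosure.le_closure _)

variable (L) in
/-- The embedding `⟨f⟩ ↦ ⟨f₀⟩` of the subbilocales of `L` into the fixed sublocales of `L₀`. -/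
def baseEmbedding : ExtSub L ↪o {x : ExtSub L.ambient // L.inducedClosure x = x} :=
  OrderEmbedding.ofMapLEIff
    (fun x => ⟨L.baseHom.antisymmetrization x, inducedClosure_baseHom x⟩) fun x y => by
      induction x using Antisymmetrization.induction_on with | _ F
      induction y using Antisymmetrization.induction_on with | _ G
      exact toAntisymmetrization_le_toAntisymmetrization_iff.trans
        ((Frm.extremalQuot_le_iff.trans extremalQuot_le_iff.symm).trans
          toAntisymmetrization_le_toAntisymmetrization_iff.symm)

theorem baseEmbedding_surjective : Function.Surjective L.baseEmbedding := by
  rintro ⟨x, hx⟩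
  induction x using Antisymmetrization.induction_on with | _ G
  -- The ambient map of this quotient biframe is by definition the one representing the closure of
  -- `⟨G⟩`, so `hx` is the required equation.
  exact ⟨ExtSub.mk _ (extremalEpi_toImage (r := L.kerRel G.hom) fun _ _ h => h.1),
    Subtype.ext hx⟩

end BiFrm

theorem mainTheorem4 (L : BiFrm.{u}) :
    -- the poset of subbilocales of `L` is a complete lattice
    (∀ A : Set (ExtSub L), (∃ s, IsLUB A s) ∧ ∃ i, IsGLB A i) ∧
    -- every extremal epimorphism `f` out of `L₀` has an induced map `f̄`,
    -- and every such `f̄` is again an extremal epimorphism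
    (∀ (S : Frm.{u}) (f : L.ambient ⟶ S), ExtremalEpi f →
      ∃ (P : Frm.{u}) (fbar : L.ambient ⟶ P), L.IsInduced f fbar) ∧
    (∀ (S P : Frm.{u}) (f : L.ambient ⟶ S) (fbar : L.ambient ⟶ P), ExtremalEpi f →
      L.IsInduced f fbar → ExtremalEpi fbar) ∧
    -- `⟨f⟩ ↦ ⟨f̄⟩` is a (well-defined) closure operator `B` on the sublocales of `L₀`
    ∃ B : ClosureOperator (ExtSub L.ambient),
      (∀ (S P : Frm.{u}) (f : L.ambient ⟶ S) (fbar : L.ambient ⟶ P)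
        (hf : ExtremalEpi f) (hfbar : ExtremalEpi fbar), L.IsInduced f fbar →
          B (ExtSub.mk f hf) = ExtSub.mk fbar hfbar) ∧
      -- and the poset of subbilocales of `L` is isomorphic to the fixed points of `B`,
      -- through `⟨f⟩ ↦ ⟨f₀⟩`
      ∃ e : ExtSub L ≃o {x : ExtSub L.ambient // B x = x},
        ∀ (M : BiFrm.{u}) (f : L ⟶ M) (hf : ExtremalEpi f),
          ∃ hf₀ : ExtremalEpi f.base, (e (ExtSub.mk f hf) : ExtSub L.ambient) =
            ExtSub.mk f.base hf₀ :=
  ⟨fun A => ⟨BiFrm.exists_isLUB A, BiFrm.exists_isGLB A⟩,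
    fun _ f _ => ⟨_, _, BiFrm.isInduced_proj f⟩,
    fun _ _ _ _ _ h => h.extremalEpi,
    L.inducedClosure, fun _ _ _ _ hf hfbar h => BiFrm.inducedClosure_eq hf hfbar h,
    RelIso.ofSurjective L.baseEmbedding BiFrm.baseEmbedding_surjective,
    fun _ _ hf => ⟨BiFrm.extremalEpi_base hf, rfl⟩⟩
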